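/- Let Sol be $\mathbb{R}^3$ with the Riemannian metric $e^{-2z}dx^2+e^{2z}dy^2+dz^2$ (left invariant for the group law $(x,y,z)*(a,b,c)=(e^{z}a+x,\,e^{-z}b+y,\,c+z)$), and let $E:\mathbb{R}^3\to\mathrm{Sol}$ be its Riemannian exponential map at the identity $0$, where the Lie algebra (the tangent space at $0$) is identified with $\mathbb{R}^3$ through the standard basis. For $V=(x,y,z)\in\mathbb{R}^3$ put $$\mu(V)=\mathrm{AGM}\Big(\sqrt{|xy|},\ \tfrac12\sqrt{(|x|+|y|)^2+z^2}\Big),$$ where $\mathrm{AGM}$ is the arithmetic-geometric mean. Call $V$ small if $\mu(V)<\pi$ and perfect if $\mu(V)=\pi$. Let $N'$ be the set of small vectors, $\partial N'$ the set of perfect vectors, and $\Pi'$ and $\Pi$ the plane $\{z=0\}$ in the Lie algebra and in Sol, respectively. Let $\partial_0N'=\partial N'\cap\Pi'$ and $\partial_0N=E(\partial_0N')\subset\Pi$. Let $\partial N\subset\Pi$ be the closure of the set of points of $\Pi$ which $\partial_0N$ separates from the origin, that is, of the points of $\Pi\setminus\partial_0N$ that do not lie in the connected component of $\Pi\setminus\partial_0N$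 containing the origin. Let $N=\mathrm{Sol}\setminus\partial N$. **Corollary 3.4.** $E(N')\subset N$. -/

import Mathlib

namespace Sol

noncomputable section

open Set Metric
open scoped Manifold

/-! Points of Sol, and vectors of its Lie algebra (the tangent space at the identity `0`, with the
standard basis), are triples `(x, y, z)`, written as functions `Fin 3 → ℝ`; the coordinates of `p`
are `p 0`, `p 1`, `p 2`. -/

/-! ### Geodesics of a metric tensor on `ℝ³` -/

/-- The partial derivative `∂ᵢ f` at `p`. -/
def partialDeriv (i : Fin 3) (f : (Fin 3 → ℝ) → ℝ) (p : Fin 3 → ℝ) : ℝ :=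
  fderiv ℝ f p (Pi.single i 1)

/-- The Christoffel symbol `Γᵏᵢⱼ` at `p` of the Levi-Civita connection of the metric tensor `g`:
`½ ∑ₗ gᵏˡ (∂ᵢ gⱼₗ + ∂ⱼ gᵢₗ - ∂ₗ gᵢⱼ)`. -/
def christoffel (g : (Fin 3 → ℝ) → Matrix (Fin 3) (Fin 3) ℝ) (k i j : Fin 3)
    (p : Fin 3 → ℝ) : ℝ :=
  1 / 2 * ∑ l, (g p)⁻¹ k l *
    (partialDeriv i (fun q => g q j l) p + partialDeriv j (fun q => g q i l) p
      - partialDeriv l (fun q => g q i j) p)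

/-- `γ` is a (complete, affinely parametrized) geodesic of `g`:
`γ''ᵏ + ∑ᵢⱼ Γᵏᵢⱼ(γ) γ'ⁱ γ'ʲ = 0`. -/
def IsGeodesic (g : (Fin 3 → ℝ) → Matrix (Fin 3) (Fin 3) ℝ) (γ : ℝ → Fin 3 → ℝ) : Prop :=
  ContDiff ℝ 2 γ ∧ ∀ (t : ℝ) (k : Fin 3),
    deriv (deriv γ) t k
      + ∑ i, ∑ j, christoffel g k i j (γ t) * deriv γ t i * deriv γ t j = 0

/-- The left-invariant metric `e^{-2z} dx² + e^{2z} dy² + dz²` of Sol. -/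
def metric (p : Fin 3 → ℝ) : Matrix (Fin 3) (Fin 3) ℝ :=
  Matrix.diagonal ![Real.exp (-2 * p 2), Real.exp (2 * p 2), 1]

/-! ### Completeness of Sol: the exponential map is defined everywhere -/

lemma metric_inv (p : Fin 3 → ℝ) :
    (metric p)⁻¹ = Matrix.diagonal ![Real.exp (2 * p 2), Real.exp (-2 * p 2), 1] := by
  apply Matrix.inv_eq_right_inv
  rw [metric, Matrix.diagonal_mul_diagonal, ← Matrix.diagonal_one]
  congr 1
  funext i
  fin_cases i <;> simp [← Real.exp_add]

lemma hasFDerivAt_coord (p : Fin 3 → ℝ) (c : ℝ) :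
    HasFDerivAt (fun q : Fin 3 → ℝ => Real.exp (c * q 2))
      (Real.exp (c * p 2) • (c • ContinuousLinearMap.proj (R := ℝ) (φ := fun _ : Fin 3 => ℝ) 2))
      p := by
  have h : HasFDerivAt (fun q : Fin 3 → ℝ => q 2)
      (ContinuousLinearMap.proj (R := ℝ) (φ := fun _ : Fin 3 => ℝ) 2) p :=
    hasFDerivAt_apply 2 p
  exact (h.const_mul c).exp

lemma partialDeriv_metric (i j l : Fin 3) (p : Fin 3 → ℝ) :
    partialDeriv i (fun q => metric q j l) p =
      if i = 2 ∧ j = 0 ∧ l = 0 then -2 * Real.exp (-2 * p 2)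
      else if i = 2 ∧ j = 1 ∧ l = 1 then 2 * Real.exp (2 * p 2) else 0 := by
  have h0 := (hasFDerivAt_coord p (-2)).fderiv
  have h1 := (hasFDerivAt_coord p 2).fderiv
  simp only [neg_mul] at h0
  fin_cases j <;> fin_cases l <;> fin_cases i <;>
    simp [partialDeriv, metric, h0, h1, mul_comm]

/-- The geodesic equations of Sol written out. -/
lemma isGeodesic_metric_iff (γ : ℝ → Fin 3 → ℝ) :
    IsGeodesic metric γ ↔ ContDiff ℝ 2 γ ∧ ∀ t,
      deriv (deriv γ) t 0 = 2 * deriv γ t 0 * deriv γ t 2 ∧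
      deriv (deriv γ) t 1 = -2 * deriv γ t 1 * deriv γ t 2 ∧
      deriv (deriv γ) t 2 = -Real.exp (-2 * γ t 2) * deriv γ t 0 ^ 2
        + Real.exp (2 * γ t 2) * deriv γ t 1 ^ 2 := by
  unfold IsGeodesic
  refine and_congr_right fun _ => forall_congr' fun t => ?_
  rw [Fin.forall_fin_succ, Fin.forall_fin_succ, Fin.forall_fin_succ]
  have e : Real.exp (2 * γ t 2) * Real.exp (-2 * γ t 2) = 1 := by
    rw [← Real.exp_add]; simp
  simp only [christoffel, metric_inv, partialDeriv_metric, Fin.sum_univ_three]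
  simp only [neg_mul] at e
  simp [Matrix.diagonal]
  refine and_congr ?_ (and_congr ?_ ?_)
  · constructor <;> intro h
    · linear_combination h + 2 * deriv γ t 0 * deriv γ t 2 * e
    · linear_combination h - 2 * deriv γ t 0 * deriv γ t 2 * e
  · constructor <;> intro h
    · linear_combination h - 2 * deriv γ t 1 * deriv γ t 2 * e
    · linear_combination h + 2 * deriv γ t 1 * deriv γ t 2 * e
  · constructor <;> intro h <;> linear_combination h

lemma exists_global_solution {v : (Fin 3 → ℝ) → Fin 3 → ℝ} (hv : ContDiff ℝ 1 v) {C : ℝ}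
    (hC : ∀ u, ‖v u‖ ≤ C) (u₀ : Fin 3 → ℝ) :
    ∃ u : ℝ → Fin 3 → ℝ, u 0 = u₀ ∧ ∀ t, HasDerivAt u (v (u t)) t := by
  have hC0 : 0 ≤ C := (norm_nonneg _).trans (hC 0)
  have hloc : ∀ x : Fin 3 → ℝ, ∃ γ : ℝ → Fin 3 → ℝ, γ 0 = x ∧
      IsMIntegralCurveOn (I := 𝓘(ℝ, Fin 3 → ℝ)) γ v (Ioo (-1) 1) := by
    intro x
    obtain ⟨K, hK⟩ := hv.contDiffOn.exists_lipschitzOnWith one_ne_zero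
      (convex_closedBall x (C.toNNReal : ℝ)) (isCompact_closedBall x (C.toNNReal : ℝ))
    have hPL : IsPicardLindelof (fun _ => v) (tmin := -1) (tmax := 1) ⟨0, by simp⟩ x
        C.toNNReal 0 C.toNNReal K := by
      refine IsPicardLindelof.of_time_independent (fun y _ => ?_) hK ?_
      · rw [Real.coe_toNNReal _ hC0]; exact hC y
      · simp
    obtain ⟨α, h0, hα⟩ := hPL.exists_eq_forall_mem_Icc_hasDerivWithinAt₀
    refine ⟨α, h0, fun t ht => ?_⟩
    have := (hα t ⟨ht.1.le, ht.2.le⟩).hasDerivAt (Icc_mem_nhds ht.1 ht.2)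
    exact this.hasFDerivAt.hasMFDerivAt.hasMFDerivWithinAt
  obtain ⟨u, h0, hu⟩ := exists_isMIntegralCurve_of_isMIntegralCurveOn
    (I := 𝓘(ℝ, Fin 3 → ℝ)) (v := v) (contMDiff_vectorSpace_iff_contDiff.2 hv) one_pos hloc u₀
  refine ⟨u, h0, fun t => ?_⟩
  have h : HasFDerivAt u ((1 : ℝ →L[ℝ] ℝ).smulRight (v (u t))) t :=
    hasMFDerivAt_iff_hasFDerivAt.1 (hu t)
  exact h.hasDerivAt.congr_deriv (by simp)

lemma eq_of_solutions {E : Type*} [NormedAddCommGroup E] [NormedSpace ℝ E] [CompleteSpace E]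
    {v : E → E} (hv : ContDiff ℝ 1 v) {u w : ℝ → E} (hu : ∀ t, HasDerivAt u (v (u t)) t)
    (hw : ∀ t, HasDerivAt w (v (w t)) t) (h : u 0 = w 0) : u = w :=
  isMIntegralCurve_Ioo_eq_of_contMDiff_boundaryless (I := 𝓘(ℝ, E)) (v := v) (t₀ := 0)
    (contMDiff_vectorSpace_iff_contDiff.2 hv)
    (fun t => (hu t).hasFDerivAt.hasMFDerivAt) (fun t => (hw t).hasFDerivAt.hasMFDerivAt) h

/-- The geodesic flow in the left-invariant frame is complete. -/
lemma exists_flow (V : Fin 3 → ℝ) : ∃ a b c : ℝ → ℝ, a 0 = V 0 ∧ b 0 = V 1 ∧ c 0 = V 2 ∧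
    ∀ t, HasDerivAt a (a t * c t) t ∧ HasDerivAt b (-(b t * c t)) t ∧
      HasDerivAt c (b t ^ 2 - a t ^ 2) t := by
  set R : ℝ := V 0 ^ 2 + V 1 ^ 2 + V 2 ^ 2 with hR
  have hR0 : 0 ≤ R := by positivity
  let φ : (Fin 3 → ℝ) → ℝ := fun u => (1 + R) / (1 + (u 0 ^ 2 + u 1 ^ 2 + u 2 ^ 2))
  let v : (Fin 3 → ℝ) → Fin 3 → ℝ := fun u =>
    ![φ u * (u 0 * u 2), φ u * (-(u 1 * u 2)), φ u * (u 1 ^ 2 - u 0 ^ 2)]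
  have hpos : ∀ u : Fin 3 → ℝ, 0 < 1 + (u 0 ^ 2 + u 1 ^ 2 + u 2 ^ 2) := fun u => by positivity
  have hφ : ContDiff ℝ 1 φ := by
    refine ContDiff.div (by fun_prop) (by fun_prop) fun u => (hpos u).ne'
  have hv : ContDiff ℝ 1 v := by
    rw [contDiff_pi]
    intro i
    fin_cases i <;> simp [v] <;> fun_prop
  have hb : ∀ (u : Fin 3 → ℝ) (w : ℝ), |w| ≤ 1 + (u 0 ^ 2 + u 1 ^ 2 + u 2 ^ 2) →
      |φ u * w| ≤ 1 + R := by
    intro u w hw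
    have : |φ u| = (1 + R) / (1 + (u 0 ^ 2 + u 1 ^ 2 + u 2 ^ 2)) :=
      abs_of_nonneg (div_nonneg (by linarith) (hpos u).le)
    rw [abs_mul, this, div_mul_eq_mul_div, div_le_iff₀ (hpos u)]
    gcongr
  have hC : ∀ u, ‖v u‖ ≤ 1 + R := by
    intro u
    rw [pi_norm_le_iff_of_nonneg (by linarith)]
    intro i
    rw [Real.norm_eq_abs]
    fin_cases i
    · exact hb u _ (abs_le.2 ⟨by nlinarith [sq_nonneg (u 0 + u 2), sq_nonneg (u 1)],
        by nlinarith [sq_nonneg (u 0 - u 2), sq_nonneg (u 1)]⟩)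
    · exact hb u _ (abs_le.2 ⟨by nlinarith [sq_nonneg (u 1 - u 2), sq_nonneg (u 0)],
        by nlinarith [sq_nonneg (u 1 + u 2), sq_nonneg (u 0)]⟩)
    · exact hb u _ (abs_le.2 ⟨by nlinarith [sq_nonneg (u 1), sq_nonneg (u 0), sq_nonneg (u 2)],
        by nlinarith [sq_nonneg (u 1), sq_nonneg (u 0), sq_nonneg (u 2)]⟩)
  obtain ⟨u, h0, hu⟩ := exists_global_solution hv hC V
  have hu' : ∀ t i, HasDerivAt (fun s => u s i) (v (u t) i) t := fun t => hasDerivAt_pi.1 (hu t)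
  have hconst : ∀ t, u t 0 ^ 2 + u t 1 ^ 2 + u t 2 ^ 2 = R := by
    have hd : ∀ t, HasDerivAt (fun s => u s 0 ^ 2 + u s 1 ^ 2 + u s 2 ^ 2) 0 t := by
      intro t
      have := (((hu' t 0).pow 2).add ((hu' t 1).pow 2)).add ((hu' t 2).pow 2)
      refine HasDerivAt.congr_deriv this ?_
      simp [v]
      ring
    intro t
    have := is_const_of_deriv_eq_zero (fun t => (hd t).differentiableAt)
      (fun t => (hd t).deriv) t 0
    simpa [h0, hR] using this
  have hone : ∀ t, φ (u t) = 1 := fun t => by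
    simp only [φ, hconst t]
    exact div_self (by linarith)
  refine ⟨fun t => u t 0, fun t => u t 1, fun t => u t 2, by simp [h0], by simp [h0],
    by simp [h0], fun t => ⟨?_, ?_, ?_⟩⟩
  · simpa [v, hone] using hu' t 0
  · simpa [v, hone] using hu' t 1
  · simpa [v, hone] using hu' t 2

/-- From the identity of Sol there issues exactly one geodesic with a given initial velocity, and
it is defined for all times. -/
theorem existsUnique_geodesic (V : Fin 3 → ℝ) :
    ∃! γ : ℝ → Fin 3 → ℝ, IsGeodesic metric γ ∧ γ 0 = 0 ∧ deriv γ 0 = V := by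
  apply existsUnique_of_exists_of_unique
  · obtain ⟨a, b, c, ha0, hb0, hc0, h⟩ := exists_flow V
    have ha : Differentiable ℝ a := fun t => (h t).1.differentiableAt
    have hb : Differentiable ℝ b := fun t => (h t).2.1.differentiableAt
    have hc : Differentiable ℝ c := fun t => (h t).2.2.differentiableAt
    have prim : ∀ f : ℝ → ℝ, Continuous f → ∀ t,
        HasDerivAt (fun s => ∫ r in (0 : ℝ)..s, f r) (f t) t := fun f hf t =>
      intervalIntegral.integral_hasDerivAt_right (hf.intervalIntegrable _ _)
        (hf.stronglyMeasurableAtFilter _ _) hf.continuousAt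
    let z : ℝ → ℝ := fun s => ∫ r in (0 : ℝ)..s, c r
    have hz : ∀ t, HasDerivAt z (c t) t := prim c hc.continuous
    have hzd : Differentiable ℝ z := fun t => (hz t).differentiableAt
    let f : ℝ → ℝ := fun t => Real.exp (z t) * a t
    let g : ℝ → ℝ := fun t => Real.exp (-z t) * b t
    have hf : ∀ t, HasDerivAt f (2 * f t * c t) t := fun t => by
      refine HasDerivAt.congr_deriv ((hz t).exp.mul (h t).1) ?_
      simp only [f]; ring
    have hg : ∀ t, HasDerivAt g (-2 * g t * c t) t := fun t => by
      refine HasDerivAt.congr_deriv ((hz t).neg.exp.mul (h t).2.1) ?_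
      simp only [g, Pi.neg_apply]; ring
    have hfc : Continuous f := continuous_iff_continuousAt.2 fun t => (hf t).continuousAt
    have hgc : Continuous g := continuous_iff_continuousAt.2 fun t => (hg t).continuousAt
    let γ : ℝ → Fin 3 → ℝ := fun t =>
      ![∫ r in (0 : ℝ)..t, f r, ∫ r in (0 : ℝ)..t, g r, z t]
    let γ' : ℝ → Fin 3 → ℝ := fun t => ![f t, g t, c t]
    let γ'' : ℝ → Fin 3 → ℝ := fun t => ![2 * f t * c t, -2 * g t * c t, b t ^ 2 - a t ^ 2]
    have hγ : ∀ t, HasDerivAt γ (γ' t) t := fun t => by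
      rw [hasDerivAt_pi]
      intro i
      fin_cases i
      · exact prim f hfc t
      · exact prim g hgc t
      · exact hz t
    have hγ' : ∀ t, HasDerivAt γ' (γ'' t) t := fun t => by
      rw [hasDerivAt_pi]
      intro i
      fin_cases i
      · exact hf t
      · exact hg t
      · exact (h t).2.2
    have hd : deriv γ = γ' := funext fun t => (hγ t).deriv
    have hd' : deriv γ' = γ'' := funext fun t => (hγ' t).deriv
    have hcont : Continuous γ'' := by
      refine continuous_pi fun i => ?_
      have := ha.continuous
      have := hb.continuous
      have := hc.continuous
      fin_cases i <;> simp [γ''] <;> fun_prop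
    have hγ'1 : ContDiff ℝ 1 γ' :=
      contDiff_one_iff_deriv.2 ⟨fun t => (hγ' t).differentiableAt, by rwa [hd']⟩
    have hγ2 : ContDiff ℝ 2 γ := by
      rw [show (2 : WithTop ℕ∞) = 1 + 1 by norm_num, contDiff_succ_iff_deriv]
      exact ⟨fun t => (hγ t).differentiableAt, by simp, by rwa [hd]⟩
    refine ⟨γ, (isGeodesic_metric_iff γ).2 ⟨hγ2, fun t => ?_⟩, ?_, ?_⟩
    · rw [hd, hd']
      refine ⟨by simp [γ', γ''], by simp [γ', γ''], ?_⟩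
      have e1 : Real.exp (-2 * z t) * Real.exp (z t) ^ 2 = 1 := by
        rw [← Real.exp_nat_mul, ← Real.exp_add]; simp
      have e2 : Real.exp (2 * z t) * Real.exp (-z t) ^ 2 = 1 := by
        rw [← Real.exp_nat_mul, ← Real.exp_add]; simp
      change b t ^ 2 - a t ^ 2 = -Real.exp (-2 * z t) * (Real.exp (z t) * a t) ^ 2
        + Real.exp (2 * z t) * (Real.exp (-z t) * b t) ^ 2
      linear_combination a t ^ 2 * e1 - b t ^ 2 * e2
    · funext i
      fin_cases i <;> simp [γ, z]
    · rw [hd]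
      funext i
      fin_cases i <;> simp [γ', f, g, z, ha0, hb0, hc0]
  · rintro γ₁ γ₂ ⟨h₁, h₁0, h₁V⟩ ⟨h₂, h₂0, h₂V⟩
    let F : (Fin 3 → ℝ) × (Fin 3 → ℝ) → (Fin 3 → ℝ) × (Fin 3 → ℝ) := fun w =>
      (w.2, ![2 * w.2 0 * w.2 2, -2 * w.2 1 * w.2 2,
        -Real.exp (-2 * w.1 2) * w.2 0 ^ 2 + Real.exp (2 * w.1 2) * w.2 1 ^ 2])
    have hF : ContDiff ℝ 1 F := by
      refine contDiff_snd.prodMk (contDiff_pi.2 fun i => ?_)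
      fin_cases i <;> simp <;> fun_prop
    have key : ∀ γ : ℝ → Fin 3 → ℝ, IsGeodesic metric γ →
        ∀ t, HasDerivAt (fun s => (γ s, deriv γ s)) (F (γ t, deriv γ t)) t := by
      intro γ hγ t
      obtain ⟨h2, heq⟩ := (isGeodesic_metric_iff γ).1 hγ
      rw [show (2 : WithTop ℕ∞) = 1 + 1 by norm_num, contDiff_succ_iff_deriv] at h2
      have hd1 := (h2.1 t).hasDerivAt
      have hd2 := (h2.2.2.differentiable one_ne_zero t).hasDerivAt
      convert hd1.prodMk hd2 using 1
      refine Prod.ext rfl (funext fun i => ?_)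
      obtain ⟨e0, e1, e2⟩ := heq t
      fin_cases i
      · exact e0.symm
      · exact e1.symm
      · exact e2.symm
    have := eq_of_solutions hF (key γ₁ h₁) (key γ₂ h₂) (by simp [h₁0, h₁V, h₂0, h₂V])
    funext t
    exact congrArg Prod.fst (congrFun this t)

/-! ### The exponential map, small and perfect vectors, and the sets `N` and `∂N` -/

/-- The Riemannian exponential map `E` of Sol at the identity: `E V = γ 1`, where `γ` is the
geodesic with `γ 0 = 0` and `γ' 0 = V`. -/
def E (V : Fin 3 → ℝ) : Fin 3 → ℝ :=
  (existsUnique_geodesic V).choose 1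

/-- `μ(x, y, z) = AGM(√|xy|, ½ √((|x| + |y|)² + z²))`. -/
def mu (V : Fin 3 → ℝ) : ℝ :=
  NNReal.agm (Real.toNNReal √|V 0 * V 1|)
    (Real.toNNReal (1 / 2 * √((|V 0| + |V 1|) ^ 2 + V 2 ^ 2)))

/-- `N'`, the set of small vectors. -/
def smallVectors : Set (Fin 3 → ℝ) := {V | mu V < Real.pi}

/-- `∂N'`, the set of perfect vectors. -/
def perfectVectors : Set (Fin 3 → ℝ) := {V | mu V = Real.pi}

/-- The plane `z = 0` (`Π'` in the Lie algebra, `Π` in Sol). -/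
def plane : Set (Fin 3 → ℝ) := {p | p 2 = 0}

/-- `∂₀N = E(∂N' ∩ Π')`. -/
def boundaryCurves : Set (Fin 3 → ℝ) := E '' (perfectVectors ∩ plane)

/-- The points of `Π` which `∂₀N` separates from the origin: those of `Π ∖ ∂₀N` lying in another
connected component of `Π ∖ ∂₀N` than the origin. -/
def separatedPoints : Set (Fin 3 → ℝ) :=
  (plane \ boundaryCurves) \ connectedComponentIn (plane \ boundaryCurves) 0

/-- `∂N`, the closure of the set of points of `Π` which `∂₀N` separates from the origin. -/
def boundaryN : Set (Fin 3 → ℝ) := closure separatedPoints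

/-- `N = Sol ∖ ∂N`. -/
def N : Set (Fin 3 → ℝ) := boundaryNᶜ

end

end Sol

/-!
Write a geodesic issuing from the identity in the left-invariant frame. The horizontal components of
its velocity are `± m eᵘ` and `± m e⁻ᵘ` with `m` constant, and the vertical one is `u'`, where
`u'' = -2 m² sinh 2u`. Unless the geodesic stays in one of the totally geodesic planes `x = 0` and
`y = 0`, one can put `sinh u = k sin θ` with `k` constant and `u' = 2 m k cos θ`; then
`θ' = 2 m √(1 + k² sin² θ)`, and the exponential map becomes a pair of integrals in `θ`
(`exists_E_eq`). By Gauss's formula (`ellipticIntegral_eq`, proved with Landen's transformation) `θ`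
makes a full turn in the time `π / μ(V)`. So `V` is small if `θ` makes less than a full turn in unit
time, and perfect if it makes exactly one.

If `V` is small and `E V` lies in the plane `Π`, then `u` takes the same value at both ends, so that
the geodesic is symmetric about its midpoint, at which `u` is extremal with `sinh u = k`. If `α < π`
is half the increase of `θ`, then `E V` is the point `(returnCoord k α, returnCoord (-k) α)`, up to
signs; perfect vectors in `Π'` give the same with `α = π` (`E_eq_returnCoord`). These points form a
curve which meets each ray of the open quadrant just once: writing `A = arsinh k`, the point has
`x / y = e²ᴬ`, and `x y = (2 halfArc k π)²` increases with `|k|`.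

The heart of the matter is that for `k ≥ 0` and `α ≤ π` one has `x / y ≥ e²ᴬ`
(`exp_mul_halfArc_neg_le`). On the other hand `x y` is smaller for `α < π` than for `α = π`. So such
a point lies strictly below the curve of perfect images (`returnCoord_ne`). Letting `α` shrink to `0`
joins `E V` to the origin within `Π` without meeting that curve, which is closed; hence a whole
neighbourhood of `E V` in `Π` is not separated from the origin.
-/

namespace Sol

open Real Set Filter Topology

/-! ### Gauss's formula for the arithmetic-geometric mean -/

/-- The complete elliptic integral `∫₀^{2π} dθ / √(a² cos² θ + b² sin² θ)`. -/
noncomputable def ellipticIntegral (a b : ℝ) : ℝ :=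
  ∫ θ in (0 : ℝ)..2 * π, (√(a ^ 2 * cos θ ^ 2 + b ^ 2 * sin θ ^ 2))⁻¹

lemma sq_mul_cos_add_sq_mul_sin_pos {a b : ℝ} (ha : 0 < a) (hb : 0 < b) (θ : ℝ) :
    0 < a ^ 2 * cos θ ^ 2 + b ^ 2 * sin θ ^ 2 := by
  have h := sin_sq_add_cos_sq θ
  rcases eq_or_ne (cos θ) 0 with h0 | h0
  · rw [h0] at h ⊢
    have : sin θ ^ 2 = 1 := by linarith
    rw [this]; positivity
  · positivity

lemma continuous_inv_sqrt_sq_mul_cos_add {a b : ℝ} (ha : 0 < a) (hb : 0 < b) :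
    Continuous fun θ : ℝ => (√(a ^ 2 * cos θ ^ 2 + b ^ 2 * sin θ ^ 2))⁻¹ := by
  refine Continuous.inv₀ (by fun_prop) fun θ => ?_
  exact (sqrt_pos.2 (sq_mul_cos_add_sq_mul_sin_pos ha hb θ)).ne'

/-- Landen's transformation: the substitution `φ = π / 2 + θ + ψ`, where `a tan ψ = b tan θ`,
leaves the elliptic integral invariant. -/
lemma ellipticIntegral_means {a b : ℝ} (ha : 0 < a) (hb : 0 < b) :
    ellipticIntegral (√(a * b)) ((a + b) / 2) = ellipticIntegral a b := by
  have hg : 0 < √(a * b) := sqrt_pos.2 (mul_pos ha hb)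
  have hm : 0 < (a + b) / 2 := by positivity
  have hcont := continuous_inv_sqrt_sq_mul_cos_add hg hm
  set w : ℝ → ℝ :=
    fun φ => (√(√(a * b) ^ 2 * cos φ ^ 2 + ((a + b) / 2) ^ 2 * sin φ ^ 2))⁻¹ with hw
  let L : ℝ → ℝ := fun θ => a * cos θ ^ 2 + b * sin θ ^ 2
  let D : ℝ → ℝ := fun θ => a ^ 2 * cos θ ^ 2 + b ^ 2 * sin θ ^ 2
  have hL : ∀ θ, 0 < L θ := fun θ => by
    have := sq_mul_cos_add_sq_mul_sin_pos (sqrt_pos.2 ha) (sqrt_pos.2 hb) θ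
    rwa [sq_sqrt ha.le, sq_sqrt hb.le] at this
  have hD : ∀ θ, 0 < D θ := sq_mul_cos_add_sq_mul_sin_pos ha hb
  have hq : ∀ θ, 1 + ((b - a) * (sin θ * cos θ) / L θ) ^ 2 = D θ / L θ ^ 2 := fun θ => by
    have := (hL θ).ne'
    field_simp
    simp only [L, D]
    rw [cos_sq']
    ring
  let φ : ℝ → ℝ := fun θ => 2 * θ + arctan ((b - a) * (sin θ * cos θ) / L θ) + π / 2
  have hφ : ∀ θ, HasDerivAt φ ((a + b) * L θ / D θ) θ := fun θ => by
    have h1 : HasDerivAt L (2 * (b - a) * (sin θ * cos θ)) θ := by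
      refine HasDerivAt.congr_deriv ((((hasDerivAt_cos θ).pow 2).const_mul a).add
        (((hasDerivAt_sin θ).pow 2).const_mul b)) ?_
      simp; ring
    have h2 := ((((hasDerivAt_sin θ).mul (hasDerivAt_cos θ)).const_mul (b - a)).div h1
      (hL θ).ne').arctan
    refine HasDerivAt.congr_deriv
      ((((hasDerivAt_id θ).const_mul 2).add h2).add_const (π / 2)) ?_
    simp only [Pi.mul_apply, Pi.div_apply]
    rw [hq]
    have := (hL θ).ne'
    have := (hD θ).ne'
    field_simp
    simp only [L, D]
    have := sin_sq θ
    linear_combination (a * b * (cos θ ^ 2 + sin θ ^ 2) - a ^ 2 * cos θ ^ 2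
      - b ^ 2 * sin θ ^ 2) * this
  have hpt : ∀ θ, w (φ θ) * ((a + b) * L θ / D θ)
      = 2 * (√(a ^ 2 * cos θ ^ 2 + b ^ 2 * sin θ ^ 2))⁻¹ := fun θ => by
    change _ = 2 * (√(D θ))⁻¹
    have hcs : √(a * b) ^ 2 * cos (φ θ) ^ 2 + ((a + b) / 2) ^ 2 * sin (φ θ) ^ 2
        = ((a + b) / 2 * L θ) ^ 2 / D θ := by
      have hr : (√(1 + ((b - a) * (sin θ * cos θ) / L θ) ^ 2)) ^ 2 = D θ / L θ ^ 2 := by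
        rw [sq_sqrt (by positivity), hq]
      have hr0 : √(1 + ((b - a) * (sin θ * cos θ) / L θ) ^ 2) ≠ 0 := by positivity
      have hLθ := (hL θ).ne'
      have hDθ := (hD θ).ne'
      have h1 : cos (2 * θ) - (b - a) * (sin θ * cos θ) / L θ * sin (2 * θ)
          = (a * cos θ ^ 2 - b * sin θ ^ 2) / L θ := by
        rw [cos_two_mul', sin_two_mul]
        field_simp
        simp only [L]
        linear_combination (a * cos θ ^ 2 - b * sin θ ^ 2) * sin_sq_add_cos_sq θ
      have h2 : sin (2 * θ) + (b - a) * (sin θ * cos θ) / L θ * cos (2 * θ)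
          = (a + b) * (sin θ * cos θ) / L θ := by
        rw [cos_two_mul', sin_two_mul]
        field_simp
        simp only [L]
        linear_combination (a + b) * sin θ * cos θ * sin_sq_add_cos_sq θ
      simp only [φ]
      rw [cos_add_pi_div_two, sin_add_pi_div_two, sin_add, cos_add, cos_arctan, sin_arctan,
        sq_sqrt (mul_pos ha hb).le]
      set q := (b - a) * (sin θ * cos θ) / L θ with hq'
      set R := √(1 + q ^ 2)
      have e1 : cos (2 * θ) * (1 / R) - sin (2 * θ) * (q / R)
          = (a * cos θ ^ 2 - b * sin θ ^ 2) / L θ / R := by rw [← h1]; ring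
      have e2 : sin (2 * θ) * (1 / R) + cos (2 * θ) * (q / R)
          = (a + b) * (sin θ * cos θ) / L θ / R := by rw [← h2]; ring
      rw [e1, e2, neg_sq, div_pow _ R, div_pow _ R, hr]
      field_simp
      simp only [L]
      ring
    simp only [hw]
    rw [hcs, sqrt_div (sq_nonneg _), sqrt_sq (by have := hL θ; positivity)]
    have := (hL θ).ne'
    have h2 : √(D θ) ≠ 0 := (sqrt_pos.2 (hD θ)).ne'
    have h3 : D θ = √(D θ) ^ 2 := (sq_sqrt (hD θ).le).symm
    have : a + b ≠ 0 := by positivity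
    rw [h3, sqrt_sq (sqrt_nonneg _)]
    field_simp
  have hsub := intervalIntegral.integral_comp_mul_deriv (a := 0) (b := 2 * π)
    (fun θ _ => hφ θ) (by
      refine Continuous.continuousOn (Continuous.div (by fun_prop) (by fun_prop)
        fun θ => (hD θ).ne')) hcont
  have hper : Function.Periodic w (2 * π) := fun x => by simp [hw]
  simp only [Function.comp_def, hpt] at hsub
  rw [intervalIntegral.integral_const_mul] at hsub
  have e : φ (2 * π) = φ 0 + (2 : ℤ) • (2 * π) := by simp [φ]; ring
  rw [e, hper.intervalIntegral_add_zsmul_eq 2 _ (fun _ _ => hcont.intervalIntegrable _ _)] at hsub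
  rw [hper.intervalIntegral_add_eq (φ 0) 0] at hsub
  simp at hsub
  unfold ellipticIntegral
  linarith

lemma ellipticIntegral_le {a b c : ℝ} (hc : 0 < c) (ha : c ≤ a) (hb : c ≤ b) :
    ellipticIntegral a b ≤ 2 * π / c := by
  have hbd : ∀ θ : ℝ, (√(a ^ 2 * cos θ ^ 2 + b ^ 2 * sin θ ^ 2))⁻¹ ≤ c⁻¹ := fun θ => by
    apply inv_anti₀ hc
    apply le_sqrt_of_sq_le
    calc c ^ 2 = c ^ 2 * cos θ ^ 2 + c ^ 2 * sin θ ^ 2 := by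
          rw [← mul_add, cos_sq_add_sin_sq, mul_one]
      _ ≤ _ := by gcongr
  have := intervalIntegral.integral_mono_on (μ := MeasureTheory.volume) two_pi_pos.le
    ((continuous_inv_sqrt_sq_mul_cos_add (hc.trans_le ha) (hc.trans_le hb)).intervalIntegrable
      0 (2 * π)) (intervalIntegrable_const (c := c⁻¹)) fun θ _ => hbd θ
  simpa [ellipticIntegral, div_eq_mul_inv] using this

lemma le_ellipticIntegral {a b c : ℝ} (ha0 : 0 < a) (hb0 : 0 < b) (ha : a ≤ c) (hb : b ≤ c) :
    2 * π / c ≤ ellipticIntegral a b := by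
  have hbd : ∀ θ : ℝ, c⁻¹ ≤ (√(a ^ 2 * cos θ ^ 2 + b ^ 2 * sin θ ^ 2))⁻¹ := fun θ => by
    apply inv_anti₀ (sqrt_pos.2 (sq_mul_cos_add_sq_mul_sin_pos ha0 hb0 θ))
    apply sqrt_le_iff.2 ⟨(ha0.trans_le ha).le, ?_⟩
    calc _ ≤ c ^ 2 * cos θ ^ 2 + c ^ 2 * sin θ ^ 2 := by gcongr
      _ = c ^ 2 := by rw [← mul_add, cos_sq_add_sin_sq, mul_one]
  have := intervalIntegral.integral_mono_on (μ := MeasureTheory.volume) two_pi_pos.le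
    (intervalIntegrable_const (c := c⁻¹))
    ((continuous_inv_sqrt_sq_mul_cos_add ha0 hb0).intervalIntegrable 0 (2 * π))
    fun θ _ => hbd θ
  simpa [ellipticIntegral, div_eq_mul_inv] using this

open NNReal in
lemma agmSequences_fst_pos {x y : ℝ≥0} (hx : 0 < x) (hy : 0 < y) (n : ℕ) :
    0 < (agmSequences x y n).1 :=
  lt_of_lt_of_le (by simpa using ⟨hx, hy⟩) (agmSequences_fst_monotone n.zero_le)

open NNReal in
/-- Gauss's formula: the elliptic integral does not change along the sequences of means, which both
tend to the arithmetic-geometric mean. -/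
theorem ellipticIntegral_eq {x y : ℝ≥0} (hx : 0 < x) (hy : 0 < y) :
    ellipticIntegral x y = 2 * π / agm x y := by
  have hpos := agmSequences_fst_pos hx hy
  have hle : ∀ n, (agmSequences x y n).1 ≤ (agmSequences x y n).2 :=
    fun n => agmSequences_fst_le_snd n n
  have hinv : ∀ n, ellipticIntegral (agmSequences x y n).1 (agmSequences x y n).2
      = ellipticIntegral x y := fun n => by
    induction n with
    | zero =>
      rw [agmSequences_zero]
      simpa using ellipticIntegral_means (a := x) (b := y) (mod_cast hx) (mod_cast hy)
    | succ n ih =>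
      rw [← ih, agmSequences_succ']
      rw [Real.coe_sqrt, NNReal.coe_mul, NNReal.coe_div, NNReal.coe_add, NNReal.coe_two]
      exact ellipticIntegral_means (mod_cast hpos n) (mod_cast (hpos n).trans_le (hle n))
  have hM : ((agm x y : ℝ≥0) : ℝ) ≠ 0 := by exact_mod_cast (agm_pos hx hy).ne'
  have h1 : Tendsto (fun n => 2 * π / ((agmSequences x y n).1 : ℝ)) atTop (𝓝 (2 * π / agm x y)) :=
    tendsto_const_nhds.div (NNReal.tendsto_coe.2 tendsto_agmSequences_fst_agm) hM
  have h2 : Tendsto (fun n => 2 * π / ((agmSequences x y n).2 : ℝ)) atTop (𝓝 (2 * π / agm x y)) :=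
    tendsto_const_nhds.div (NNReal.tendsto_coe.2 tendsto_agmSequences_snd_agm) hM
  apply le_antisymm
  · refine ge_of_tendsto' h1 fun n => ?_
    rw [← hinv n]
    exact ellipticIntegral_le (mod_cast hpos n) le_rfl (mod_cast hle n)
  · refine le_of_tendsto' h2 fun n => ?_
    rw [← hinv n]
    exact le_ellipticIntegral (mod_cast hpos n) (mod_cast (hpos n).trans_le (hle n))
      (mod_cast hle n) le_rfl

/-! ### Symmetric arcs of geodesics -/

/-- Along a geodesic of Sol write the two horizontal components of the velocity in the
left-invariant frame as `m eᵘ` and `m e⁻ᵘ`, and put `sinh u = k sin θ`. Then `dθ/dt = 2 m cosh u`,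
and `rate (sinh u)` is `e²ᵘ / (2 cosh u)`, the derivative with respect to `θ` of the first coordinate
of the geodesic, up to a constant factor. For the second coordinate it is `rate (-sinh u)`. -/
noncomputable def rate (s : ℝ) : ℝ := exp (2 * arsinh s) / (2 * √(1 + s ^ 2))

lemma rate_pos (s : ℝ) : 0 < rate s := by unfold rate; positivity

@[fun_prop]
lemma continuous_rate : Continuous rate := by
  unfold rate
  have := continuous_arsinh
  exact Continuous.div (by fun_prop) (by fun_prop) fun s => by positivity

lemma rate_add_rate_neg (s : ℝ) : rate s + rate (-s) = 2 * √(1 + s ^ 2) - (√(1 + s ^ 2))⁻¹ := by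
  have h : exp (2 * arsinh s) + exp (-(2 * arsinh s)) = 2 * (1 + 2 * s ^ 2) := by
    have := cosh_two_mul (arsinh s)
    rw [cosh_eq, cosh_sq', sinh_arsinh] at this
    linarith
  have h2 : √(1 + s ^ 2) ^ 2 = 1 + s ^ 2 := sq_sqrt (by positivity)
  have h3 : √(1 + s ^ 2) ≠ 0 := by positivity
  simp only [rate, arsinh_neg, neg_sq, mul_neg]
  rw [← add_div, h]
  field_simp
  rw [h2]; ring

lemma rate_add_rate_neg_le {s t : ℝ} (h : |s| ≤ |t|) :
    rate s + rate (-s) ≤ rate t + rate (-t) := by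
  rw [rate_add_rate_neg, rate_add_rate_neg]
  have h1 : √(1 + s ^ 2) ≤ √(1 + t ^ 2) := sqrt_le_sqrt (by linarith [sq_le_sq.2 h])
  have h2 := inv_anti₀ (by positivity) h1
  linarith

/-- The integral of the rate along an arc which starts where `u` is extremal, `sinh u = k`, and
along which the angle `θ` grows by `α`. -/
noncomputable def halfArc (k α : ℝ) : ℝ := ∫ β in (0 : ℝ)..α, rate (k * cos β)

lemma hasDerivAt_halfArc (k α : ℝ) : HasDerivAt (halfArc k) (rate (k * cos α)) α := by
  have hc : Continuous fun β => rate (k * cos β) := by fun_prop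
  exact intervalIntegral.integral_hasDerivAt_right (hc.intervalIntegrable _ _)
    (hc.stronglyMeasurableAtFilter _ _) hc.continuousAt

@[simp]
lemma halfArc_zero (k : ℝ) : halfArc k 0 = 0 := by simp [halfArc]

lemma strictMono_halfArc (k : ℝ) : StrictMono (halfArc k) :=
  strictMono_of_deriv_pos fun α => by rw [(hasDerivAt_halfArc k α).deriv]; exact rate_pos _

lemma halfArc_neg_pi (k : ℝ) : halfArc (-k) π = halfArc k π := by
  have := intervalIntegral.integral_comp_sub_left (a := 0) (b := π)
    (fun β => rate (k * cos β)) π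
  simpa [halfArc, cos_pi_sub] using this

lemma halfArc_pi_le {k l : ℝ} (h : |k| ≤ |l|) : halfArc k π ≤ halfArc l π := by
  have hsum : ∀ k : ℝ, 2 * halfArc k π
      = ∫ β in (0 : ℝ)..π, (rate (k * cos β) + rate (-(k * cos β))) := fun k => by
    rw [intervalIntegral.integral_add
      (Continuous.intervalIntegrable (by fun_prop) _ _)
      (Continuous.intervalIntegrable (by fun_prop) _ _), two_mul]
    nth_rw 2 [← halfArc_neg_pi]
    simp [halfArc]
  have : 2 * halfArc k π ≤ 2 * halfArc l π := by
    rw [hsum, hsum]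
    refine intervalIntegral.integral_mono_on pi_pos.le
      (Continuous.intervalIntegrable (by fun_prop) _ _)
      (Continuous.intervalIntegrable (by fun_prop) _ _) fun β _ => rate_add_rate_neg_le ?_
    rw [abs_mul, abs_mul]
    gcongr
  linarith

lemma one_le_two_mul_halfArc_pi (k : ℝ) : 1 ≤ 2 * halfArc k π := by
  have h0 : halfArc 0 π = π / 2 := by
    simp [halfArc, rate]; ring
  have := halfArc_pi_le (k := 0) (l := k) (by simp)
  linarith [pi_gt_three]

lemma hasDerivAt_arsinh_mul_cos (k β : ℝ) :
    HasDerivAt (fun β => arsinh (k * cos β)) (-(k * sin β) / √(1 + (k * cos β) ^ 2)) β := by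
  refine HasDerivAt.congr_deriv (((hasDerivAt_cos β).const_mul k).arsinh) ?_
  rw [smul_eq_mul]; ring

/-- The comparison that separates the images of the small vectors from the images of the perfect
ones. The difference of the two sides vanishes for `α = 0` and for `α = π`. Its derivative is a
positive multiple of `K α = e²ʳ - e²ᴬ + 4 k sin α · halfArc k α`, where `sinh r = k cos α` and
`sinh A = k`; since `K' = 4 k cos α · halfArc k α`, the function `K` increases from `0` up to
`α = π / 2` and decreases afterwards, so that the difference first increases and then decreases. -/
lemma exp_mul_halfArc_neg_le {k : ℝ} (hk : 0 ≤ k) {α : ℝ} (hα : α ∈ Icc 0 π) :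
    exp (2 * arsinh k) * halfArc (-k) α ≤ exp (-(2 * arsinh (k * cos α))) * halfArc k α := by
  let K : ℝ → ℝ := fun α =>
    exp (2 * arsinh (k * cos α)) - exp (2 * arsinh k) + 4 * k * (sin α * halfArc k α)
  let h : ℝ → ℝ := fun α =>
    exp (-(2 * arsinh (k * cos α))) * halfArc k α - exp (2 * arsinh k) * halfArc (-k) α
  have hK : ∀ α, HasDerivAt K (4 * k * cos α * halfArc k α) α := fun α => by
    refine HasDerivAt.congr_deriv
      (((((hasDerivAt_arsinh_mul_cos k α).const_mul 2).exp).sub_const _).add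
      (((hasDerivAt_sin α).mul (hasDerivAt_halfArc k α)).const_mul (4 * k))) ?_
    rw [rate]
    field_simp
    ring
  have hh : ∀ α, HasDerivAt h
      (exp (-(2 * arsinh (k * cos α))) * (2 * √(1 + (k * cos α) ^ 2))⁻¹ * K α) α := fun α => by
    refine HasDerivAt.congr_deriv
      (((((hasDerivAt_arsinh_mul_cos k α).const_mul 2).neg.exp).mul (hasDerivAt_halfArc k α)).sub
      ((hasDerivAt_halfArc (-k) α).const_mul _)) ?_
    have e : exp (-(2 * arsinh (k * cos α))) = (exp (2 * arsinh (k * cos α)))⁻¹ := exp_neg _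
    simp only [rate, neg_mul, arsinh_neg, mul_neg, neg_sq, K, e, Pi.neg_apply]
    field_simp
    ring
  have hf : ∀ α, 0 ≤ α → 0 ≤ halfArc k α := fun α hα => by
    rw [← halfArc_zero k]; exact (strictMono_halfArc k).monotone hα
  have hKc : Continuous K := continuous_iff_continuousAt.2 fun α => (hK α).continuousAt
  have hhc : Continuous h := continuous_iff_continuousAt.2 fun α => (hh α).continuousAt
  have hK0 : ∀ α ∈ Icc 0 (π / 2), 0 ≤ K α := by
    have hm : MonotoneOn K (Icc 0 (π / 2)) := by
      refine monotoneOn_of_deriv_nonneg (convex_Icc _ _) hKc.continuousOn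
        (fun α _ => (hK α).differentiableAt.differentiableWithinAt) fun α hα => ?_
      rw [interior_Icc] at hα
      rw [(hK α).deriv]
      have := cos_nonneg_of_mem_Icc ⟨by linarith [hα.1, pi_pos], hα.2.le⟩
      have := hf α hα.1.le
      positivity
    intro α hα
    have := hm ⟨le_rfl, by positivity⟩ hα hα.1
    simpa [K] using this
  have hKanti : AntitoneOn K (Icc (π / 2) π) := by
    refine antitoneOn_of_deriv_nonpos (convex_Icc _ _) hKc.continuousOn
      (fun α _ => (hK α).differentiableAt.differentiableWithinAt) fun α hα => ?_
    rw [interior_Icc] at hα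
    rw [(hK α).deriv]
    have h1 := cos_nonpos_of_pi_div_two_le_of_le hα.1.le (by linarith [hα.2, pi_pos])
    have h2 := hf α (by linarith [hα.1, pi_pos])
    exact mul_nonpos_of_nonpos_of_nonneg (mul_nonpos_of_nonneg_of_nonpos (by positivity) h1) h2
  have hpos : ∀ α, 0 < exp (-(2 * arsinh (k * cos α))) * (2 * √(1 + (k * cos α) ^ 2))⁻¹ :=
    fun α => by positivity
  suffices 0 ≤ h α by simpa [h] using this
  by_contra! hneg
  have hα0 : 0 < α := by
    rcases hα.1.eq_or_lt with h0 | h0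
    · simp [h, ← h0] at hneg
    · exact h0
  obtain ⟨ξ, hξ, hξ'⟩ := exists_hasDerivAt_eq_slope h _ hα0 hhc.continuousOn fun x _ => hh x
  have hKξ : K ξ < 0 := by
    have h0 : h 0 = 0 := by simp [h]
    rw [h0, sub_zero, sub_zero] at hξ'
    have : h α / α < 0 := div_neg_of_neg_of_pos hneg hα0
    rw [← hξ'] at this
    exact (pos_iff_neg_of_mul_neg this).1 (hpos ξ)
  have hξ2 : π / 2 < ξ := by
    by_contra! hle
    exact (hK0 ξ ⟨hξ.1.le, hle⟩).not_gt hKξ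
  have hanti : AntitoneOn h (Icc ξ π) := by
    refine antitoneOn_of_deriv_nonpos (convex_Icc _ _) hhc.continuousOn
      (fun α _ => (hh α).differentiableAt.differentiableWithinAt) fun η hη => ?_
    rw [interior_Icc] at hη
    rw [(hh η).deriv]
    have := hKanti ⟨hξ2.le, (hη.1.trans hη.2).le⟩ ⟨(hξ2.trans hη.1).le, hη.2.le⟩ hη.1.le
    exact mul_nonpos_of_nonneg_of_nonpos (hpos η).le (this.trans hKξ.le)
  have hend := hanti ⟨hξ.2.le, hα.2⟩ ⟨hξ.2.le.trans hα.2, le_rfl⟩ hα.2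
  have hπ : h π = 0 := by simp [h, halfArc_neg_pi]
  linarith

/-- The arc of `halfArc k α`, continued symmetrically beyond the point where `u` is extremal, is
carried by a left translation to a geodesic from the identity to the point
`(returnCoord k α, returnCoord (-k) α, 0)` of the plane `Π`. -/
noncomputable def returnCoord (k α : ℝ) : ℝ := 2 * exp (-arsinh (k * cos α)) * halfArc k α

lemma returnCoord_pi (k : ℝ) : returnCoord k π = exp (arsinh k) * (2 * halfArc k π) := by
  simp [returnCoord]; ring

lemma returnCoord_mul (k α : ℝ) :
    returnCoord k α * returnCoord (-k) α = 4 * (halfArc k α * halfArc (-k) α) := by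
  have : exp (-arsinh (k * cos α)) * exp (arsinh (k * cos α)) = 1 := by rw [← exp_add]; simp
  simp only [returnCoord, neg_mul, arsinh_neg, neg_neg]
  linear_combination 4 * halfArc k α * halfArc (-k) α * this

/-- A symmetric arc of less than a full period never ends where one of a full period does: the
product of the two coordinates would force `|l| < |k|`, and their quotient `|k| ≤ |l|`. -/
lemma returnCoord_ne {k α : ℝ} (hα : α ∈ Ico 0 π) (l : ℝ)
    (h₁ : returnCoord k α = returnCoord l π) : returnCoord (-k) α ≠ returnCoord (-l) π := by
  intro h₂
  -- The isometry exchanging the two horizontal coordinates replaces `k` and `l` by `-k` and `-l`.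
  wlog hk : 0 ≤ k generalizing k l
  · exact this (k := -k) (-l) h₂ (by simpa using h₁) (by linarith)
  have hnn : ∀ k, 0 ≤ halfArc k α := fun k => by
    rw [← halfArc_zero k]; exact (strictMono_halfArc k).monotone hα.1
  have hlt : halfArc l π ^ 2 < halfArc k π ^ 2 := by
    have e : 4 * (halfArc k α * halfArc (-k) α) = 4 * (halfArc l π * halfArc (-l) π) := by
      rw [← returnCoord_mul, ← returnCoord_mul, h₁, h₂]
    have := mul_lt_mul'' (strictMono_halfArc k hα.2) (strictMono_halfArc (-k) hα.2) (hnn k)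
      (hnn (-k))
    rw [halfArc_neg_pi] at this e
    nlinarith
  have hkl : k ≤ l := by
    have h := exp_mul_halfArc_neg_le hk ⟨hα.1, hα.2.le⟩
    have hr : exp (2 * arsinh k) * returnCoord (-k) α ≤ returnCoord k α := by
      have e1 : exp (-arsinh (k * cos α))
          = exp (arsinh (k * cos α)) * exp (-(2 * arsinh (k * cos α))) := by
        rw [← exp_add]; ring_nf
      have := mul_le_mul_of_nonneg_left h
        (show 0 ≤ 2 * exp (arsinh (k * cos α)) by positivity)
      calc _ = 2 * exp (arsinh (k * cos α)) * (exp (2 * arsinh k) * halfArc (-k) α) := by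
            simp [returnCoord]; ring
        _ ≤ _ := this
        _ = _ := by rw [returnCoord, e1]; ring
    rw [h₁, h₂, returnCoord_pi, returnCoord_pi, halfArc_neg_pi, ← mul_assoc,
      mul_le_mul_iff_left₀ (by linarith [one_le_two_mul_halfArc_pi l]), ← exp_add, exp_le_exp,
      arsinh_neg] at hr
    exact arsinh_le_arsinh.1 (by linarith)
  have := halfArc_pi_le (k := k) (l := l) (by rwa [abs_of_nonneg hk, abs_of_nonneg (hk.trans hkl)])
  nlinarith [one_le_two_mul_halfArc_pi k]

lemma continuous_returnCoord (k : ℝ) : Continuous (returnCoord k) := by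
  have h : Continuous (halfArc k) :=
    continuous_iff_continuousAt.2 fun α => (hasDerivAt_halfArc k α).continuousAt
  have := continuous_arsinh
  unfold returnCoord
  fun_prop

lemma continuous_returnCoord_pi : Continuous fun k => returnCoord k π := by
  have h : Continuous fun k => halfArc k π :=
    intervalIntegral.continuous_parametric_intervalIntegral_of_continuous' (by fun_prop) _ _
  have := continuous_arsinh
  unfold returnCoord
  fun_prop

/-- The curve traced by the images of perfect vectors is properly embedded in the plane. -/
lemma isClosed_range_returnCoord_pi :
    IsClosed (range fun k => (returnCoord k π, returnCoord (-k) π)) := by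
  have hle : ∀ k : ℝ, k ≤ returnCoord k π := fun k => by
    rw [returnCoord_pi]
    have h1 : k ≤ exp (arsinh k) := by
      rw [exp_arsinh]; linarith [sqrt_nonneg (1 + k ^ 2)]
    nlinarith [exp_pos (arsinh k), one_le_two_mul_halfArc_pi k]
  have hbound : ∀ k : ℝ, ‖k‖ ≤ ‖(returnCoord k π, returnCoord (-k) π)‖ := fun k => by
    rw [Prod.norm_mk, norm_eq_abs]
    rcases abs_cases k with ⟨e, _⟩ | ⟨e, _⟩ <;> rw [e]
    · exact (hle k).trans ((le_abs_self _).trans (le_max_left _ _))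
    · exact (hle (-k)).trans ((le_abs_self _).trans (le_max_right _ _))
  have hcont : Continuous fun k => (returnCoord k π, returnCoord (-k) π) :=
    continuous_returnCoord_pi.prodMk (continuous_returnCoord_pi.comp continuous_neg)
  refine (isProperMap_iff_tendsto_cocompact.2 ⟨hcont, ?_⟩).isClosedMap.isClosed_range
  rw [← Metric.cobounded_eq_cocompact (α := ℝ × ℝ), ← comap_norm_atTop, tendsto_comap_iff]
  exact tendsto_atTop_mono hbound tendsto_norm_cocompact_atTop

/-! ### The exponential map in terms of the angle -/

lemma E_eq_of_isGeodesic {γ : ℝ → Fin 3 → ℝ} (hγ : IsGeodesic metric γ) (h0 : γ 0 = 0) :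
    E (deriv γ 0) = γ 1 := by
  rw [E, (existsUnique_geodesic (deriv γ 0)).unique
    (existsUnique_geodesic (deriv γ 0)).choose_spec.1 ⟨hγ, h0, rfl⟩]

lemma exists_isGeodesic (V : Fin 3 → ℝ) :
    ∃ γ : ℝ → Fin 3 → ℝ, IsGeodesic metric γ ∧ γ 0 = 0 ∧ deriv γ 0 = V ∧ E V = γ 1 := by
  obtain ⟨γ, ⟨hγ, h0, rfl⟩, _⟩ := existsUnique_geodesic V
  exact ⟨γ, hγ, h0, rfl, E_eq_of_isGeodesic hγ h0⟩

lemma eq_zero_of_hasDerivAt_mul {y z z' : ℝ → ℝ} (hy : ∀ t, HasDerivAt y (y t * z' t) t)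
    (hz : ∀ t, HasDerivAt z (z' t) t) (h0 : y 0 = 0) (t : ℝ) : y t = 0 := by
  have hd : ∀ t, HasDerivAt (fun t => y t * exp (-z t)) 0 t := fun t => by
    refine HasDerivAt.congr_deriv ((hy t).mul (hz t).neg.exp) ?_
    simp only [Pi.neg_apply]; ring
  have := is_const_of_deriv_eq_zero (fun t => (hd t).differentiableAt) (fun t => (hd t).deriv) t 0
  simpa [h0] using this

/-- The hyperbolic planes `x = 0` and `y = 0` are totally geodesic. -/
lemma E_zero_mul_E_one_eq_zero {V : Fin 3 → ℝ} (hV : V 0 * V 1 = 0) : E V 0 * E V 1 = 0 := by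
  obtain ⟨γ, hγ, h0, hV', hE⟩ := exists_isGeodesic V
  rw [isGeodesic_metric_iff] at hγ
  obtain ⟨hγ2, heq⟩ := hγ
  rw [show (2 : WithTop ℕ∞) = 1 + 1 by norm_num, contDiff_succ_iff_deriv] at hγ2
  have h1 : ∀ t i, HasDerivAt (fun s => γ s i) (deriv γ t i) t :=
    fun t => hasDerivAt_pi.1 (hγ2.1 t).hasDerivAt
  have h2 : ∀ t i, HasDerivAt (fun s => deriv γ s i) (deriv (deriv γ) t i) t :=
    fun t => hasDerivAt_pi.1 (hγ2.2.2.differentiable one_ne_zero t).hasDerivAt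
  -- A coordinate with vanishing derivative keeps its initial value `0`.
  have hconst : ∀ i, (∀ t, deriv γ t i = 0) → γ 1 i = 0 := fun i hi => by
    have := is_const_of_deriv_eq_zero (fun t => (h1 t i).differentiableAt)
      (fun t => (h1 t i).deriv.trans (hi t)) 1 0
    simpa [h0] using this
  rw [hE]
  rcases mul_eq_zero.1 hV with h | h
  · refine mul_eq_zero_of_left (hconst 0 (eq_zero_of_hasDerivAt_mul
      (z := fun t => 2 * γ t 2) (z' := fun t => 2 * deriv γ t 2) (fun t => ?_)
      (fun t => (h1 t 2).const_mul 2) (by simpa [hV'] using h))) _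
    exact (h2 t 0).congr_deriv (by rw [(heq t).1]; ring)
  · refine mul_eq_zero_of_right _ (hconst 1 (eq_zero_of_hasDerivAt_mul
      (z := fun t => -2 * γ t 2) (z' := fun t => -2 * deriv γ t 2) (fun t => ?_)
      (fun t => (h1 t 2).const_mul (-2)) (by simpa [hV'] using h)))
    exact (h2 t 1).congr_deriv (by rw [(heq t).2.1]; ring)

lemma hasDerivAt_integral_of_continuous {f : ℝ → ℝ} (hf : Continuous f) (a x : ℝ) :
    HasDerivAt (fun x => ∫ θ in a..x, f θ) (f x) x :=
  intervalIntegral.integral_hasDerivAt_right (hf.intervalIntegrable _ _)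
    (hf.stronglyMeasurableAtFilter _ _) hf.continuousAt

/-- The equation for the angle has global solutions. -/
lemma exists_angle (m k θ₀ : ℝ) : ∃ θ : ℝ → ℝ, θ 0 = θ₀ ∧
    ∀ t, HasDerivAt θ (2 * m * √(1 + (k * sin (θ t)) ^ 2)) t := by
  obtain ⟨u, h0, hu⟩ := exists_global_solution
    (v := fun u _ => 2 * m * √(1 + (k * sin (u 0)) ^ 2)) (C := |2 * m| * √(1 + k ^ 2))
    (contDiff_pi.2 fun _ => contDiff_const.mul
      (ContDiff.sqrt (by fun_prop) fun u => by positivity))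
    (fun u => by
      rw [pi_norm_le_iff_of_nonneg (by positivity)]
      intro i
      rw [norm_eq_abs, abs_mul, abs_of_nonneg (sqrt_nonneg _)]
      have : (k * sin (u 0)) ^ 2 ≤ k ^ 2 := by
        rw [mul_pow]
        exact mul_le_of_le_one_right (sq_nonneg _) (sin_sq_le_one _)
      exact mul_le_mul_of_nonneg_left (sqrt_le_sqrt (by linarith)) (abs_nonneg _))
    (fun _ => θ₀)
  exact ⟨fun t => u t 0, by simp [h0], fun t => hasDerivAt_pi.1 (hu t) 0⟩

lemma exp_two_mul_arsinh (s : ℝ) : exp (2 * arsinh s) = (s + √(1 + s ^ 2)) ^ 2 := by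
  rw [← exp_arsinh, ← exp_nat_mul]; norm_num

/-- The geodesic with initial velocity `V = (ε m e^{u₀}, δ m e^{-u₀}, 2 m k cos θ₀)`, where
`sinh u₀ = k sin θ₀`, in terms of the angle `θ`. -/
lemma exists_E_eq {m ε δ k θ₀ u₀ : ℝ} {V : Fin 3 → ℝ} (hm : 0 < m) (hε : ε ^ 2 = 1)
    (hδ : δ ^ 2 = 1) (hu : sinh u₀ = k * sin θ₀) (hV : V = ![ε * (m * exp u₀),
      δ * (m * exp (-u₀)), 2 * m * k * cos θ₀]) :
    ∃ θ₁ : ℝ, ∫ θ in θ₀..θ₁, (2 * m * √(1 + (k * sin θ) ^ 2))⁻¹ = 1 ∧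
      E V 0 = ε * (exp (-u₀) * ∫ θ in θ₀..θ₁, rate (k * sin θ)) ∧
      E V 1 = δ * (exp u₀ * ∫ θ in θ₀..θ₁, rate (-(k * sin θ))) ∧
      E V 2 = arsinh (k * sin θ₁) - u₀ := by
  obtain ⟨θ, hθ0, hθ⟩ := exists_angle m k θ₀
  have hc : ∀ t, √(1 + (k * sin (θ t)) ^ 2) ≠ 0 := fun t => by positivity
  have hc2 : ∀ t, √(1 + (k * sin (θ t)) ^ 2) ^ 2 = 1 + (k * sin (θ t)) ^ 2 :=
    fun t => sq_sqrt (by positivity)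
  let U : ℝ → ℝ := fun t => arsinh (k * sin (θ t))
  have hU : ∀ t, HasDerivAt U (2 * m * k * cos (θ t)) t := fun t => by
    refine HasDerivAt.congr_deriv ((hθ t).sin.const_mul k).arsinh ?_
    have := hc t
    rw [smul_eq_mul]
    field_simp
  have hU0 : U 0 = u₀ := by simp only [U, hθ0, ← hu, arsinh_sinh]
  let γ : ℝ → Fin 3 → ℝ := fun t => ![ε * (exp (-u₀) * ∫ x in θ₀..θ t, rate (k * sin x)),
    δ * (exp u₀ * ∫ x in θ₀..θ t, rate (-(k * sin x))), U t - u₀]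
  let γ' : ℝ → Fin 3 → ℝ := fun t => ![ε * (exp (-u₀) * (m * exp (2 * U t))),
    δ * (exp u₀ * (m * exp (-(2 * U t)))), 2 * m * k * cos (θ t)]
  let γ'' : ℝ → Fin 3 → ℝ := fun t =>
    ![2 * (ε * (exp (-u₀) * (m * exp (2 * U t)))) * (2 * m * k * cos (θ t)),
      -2 * (δ * (exp u₀ * (m * exp (-(2 * U t))))) * (2 * m * k * cos (θ t)),
      2 * m * k * (-sin (θ t) * (2 * m * √(1 + (k * sin (θ t)) ^ 2)))]
  have hγ : ∀ t, HasDerivAt γ (γ' t) t := fun t => by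
    rw [hasDerivAt_pi]
    have h0 := hasDerivAt_integral_of_continuous (f := fun x => rate (k * sin x)) (by fun_prop)
      θ₀ (θ t)
    have h1 := hasDerivAt_integral_of_continuous (f := fun x => rate (-(k * sin x)))
      (by fun_prop) θ₀ (θ t)
    have := hc t
    intro i
    fin_cases i
    · refine (((h0.comp t (hθ t)).const_mul (exp (-u₀))).const_mul ε).congr_deriv ?_
      simp only [rate, γ', U, Fin.zero_eta, Matrix.cons_val_zero]
      field_simp
    · refine (((h1.comp t (hθ t)).const_mul (exp u₀)).const_mul δ).congr_deriv ?_
      simp only [rate, γ', U, Fin.mk_one, Matrix.cons_val_one, Matrix.cons_val_zero, neg_sq,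
        arsinh_neg, mul_neg]
      field_simp
    · exact (hU t).sub_const u₀
  have hγ' : ∀ t, HasDerivAt γ' (γ'' t) t := fun t => by
    rw [hasDerivAt_pi]
    have h0 := ((hU t).const_mul 2).exp
    have h1 := ((hU t).const_mul 2).neg.exp
    intro i
    fin_cases i
    · refine (((h0.const_mul m).const_mul (exp (-u₀))).const_mul ε).congr_deriv ?_
      simp only [γ'', Fin.zero_eta, Matrix.cons_val_zero]
      ring
    · refine (((h1.const_mul m).const_mul (exp u₀)).const_mul δ).congr_deriv ?_
      simp only [γ'', Fin.mk_one, Matrix.cons_val_one, Matrix.cons_val_zero, Pi.neg_apply]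
      ring
    · exact (hθ t).cos.const_mul (2 * m * k)
  have hθc : Continuous θ := continuous_iff_continuousAt.2 fun t => (hθ t).continuousAt
  have hUc : Continuous U := continuous_iff_continuousAt.2 fun t => (hU t).continuousAt
  have hd : deriv γ = γ' := funext fun t => (hγ t).deriv
  have hd' : deriv γ' = γ'' := funext fun t => (hγ' t).deriv
  have hcont : Continuous γ'' := by
    refine continuous_pi fun i => ?_
    fin_cases i <;> simp [γ''] <;> fun_prop
  have hγ2 : ContDiff ℝ 2 γ := by
    rw [show (2 : WithTop ℕ∞) = 1 + 1 by norm_num, contDiff_succ_iff_deriv]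
    refine ⟨fun t => (hγ t).differentiableAt, by simp, ?_⟩
    rw [hd]
    exact contDiff_one_iff_deriv.2 ⟨fun t => (hγ' t).differentiableAt, by rwa [hd']⟩
  have hgeo : IsGeodesic metric γ := by
    refine (isGeodesic_metric_iff γ).2 ⟨hγ2, fun t => ?_⟩
    rw [hd, hd']
    refine ⟨by simp [γ', γ''], by simp [γ', γ''], ?_⟩
    have e1 : exp (-2 * (U t - u₀)) * (exp (-u₀) * exp (2 * U t)) ^ 2 = exp (2 * U t) := by
      rw [← exp_add, ← exp_nat_mul, ← exp_add]; push_cast; ring_nf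
    have e2 : exp (2 * (U t - u₀)) * (exp u₀ * exp (-(2 * U t))) ^ 2 = exp (-(2 * U t)) := by
      rw [← exp_add, ← exp_nat_mul, ← exp_add]; push_cast; ring_nf
    have e3 : exp (2 * U t) = (k * sin (θ t) + √(1 + (k * sin (θ t)) ^ 2)) ^ 2 :=
      exp_two_mul_arsinh _
    have e4 : exp (-(2 * U t)) = (-(k * sin (θ t)) + √(1 + (k * sin (θ t)) ^ 2)) ^ 2 := by
      have := exp_two_mul_arsinh (-(k * sin (θ t)))
      rwa [arsinh_neg, mul_neg, neg_sq] at this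
    change 2 * m * k * (-sin (θ t) * (2 * m * √(1 + (k * sin (θ t)) ^ 2)))
      = -exp (-2 * (U t - u₀)) * (ε * (exp (-u₀) * (m * exp (2 * U t)))) ^ 2
        + exp (2 * (U t - u₀)) * (δ * (exp u₀ * (m * exp (-(2 * U t))))) ^ 2
    have e5 : -exp (-2 * (U t - u₀)) * (ε * (exp (-u₀) * (m * exp (2 * U t)))) ^ 2
        + exp (2 * (U t - u₀)) * (δ * (exp u₀ * (m * exp (-(2 * U t))))) ^ 2
        = -m ^ 2 * exp (2 * U t) + m ^ 2 * exp (-(2 * U t)) := by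
      linear_combination (-ε ^ 2 * m ^ 2) * e1 + δ ^ 2 * m ^ 2 * e2
        - m ^ 2 * exp (2 * U t) * hε + m ^ 2 * exp (-(2 * U t)) * hδ
    rw [e5, e3, e4]
    ring
  have hγ0 : γ 0 = 0 := by
    funext i
    fin_cases i <;> simp [γ, hθ0, hU0]
  have hE : E V = γ 1 := by
    rw [← E_eq_of_isGeodesic hgeo hγ0, hd, hV]
    congr 1
    have e1 : exp (-u₀) * (m * exp (2 * u₀)) = m * exp u₀ := by
      rw [mul_left_comm, ← exp_add]; ring_nf
    have e2 : exp u₀ * (m * exp (-(2 * u₀))) = m * exp (-u₀) := by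
      rw [mul_left_comm, ← exp_add]; ring_nf
    simp only [γ', hU0, hθ0, e1, e2]
  refine ⟨θ 1, ?_, by rw [hE]; rfl, by rw [hE]; rfl, by rw [hE]; rfl⟩
  have hfc : Continuous fun x : ℝ => (2 * m * √(1 + (k * sin x) ^ 2))⁻¹ :=
    Continuous.inv₀ (by fun_prop) fun x => by positivity
  have htime : ∀ t, HasDerivAt
      (fun t => (∫ x in θ₀..θ t, (2 * m * √(1 + (k * sin x) ^ 2))⁻¹) - t) 0 t := fun t => by
    refine (((hasDerivAt_integral_of_continuous hfc θ₀ (θ t)).comp t (hθ t)).sub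
      (hasDerivAt_id t)).congr_deriv ?_
    have := hc t
    field_simp
    simp
  have := is_const_of_deriv_eq_zero (fun t => (htime t).differentiableAt)
    (fun t => (htime t).deriv) 1 0
  simp only [hθ0, intervalIntegral.integral_same] at this
  linarith

lemma exists_polar (x y : ℝ) : ∃ k θ : ℝ, x = k * cos θ ∧ y = k * sin θ :=
  ⟨‖(⟨x, y⟩ : ℂ)‖, Complex.arg ⟨x, y⟩, by simp, by simp⟩

lemma mu_eq {m ε δ k θ₀ u₀ : ℝ} (hm : 0 < m) (hε : |ε| = 1) (hδ : |δ| = 1)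
    (hu : sinh u₀ = k * sin θ₀) :
    mu ![ε * (m * exp u₀), δ * (m * exp (-u₀)), 2 * m * k * cos θ₀]
      = NNReal.agm m.toNNReal (m * √(1 + k ^ 2)).toNNReal := by
  have e1 : exp u₀ * exp (-u₀) = 1 := by rw [← exp_add]; simp
  have e2 : |ε * (m * exp u₀) * (δ * (m * exp (-u₀)))| = m ^ 2 := by
    have : ε * (m * exp u₀) * (δ * (m * exp (-u₀))) = ε * δ * m ^ 2 := by
      linear_combination ε * δ * m ^ 2 * e1
    rw [this, abs_mul, abs_mul, hε, hδ, abs_of_pos (by positivity)]; ring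
  have e3 : 1 / 2 * √((|ε * (m * exp u₀)| + |δ * (m * exp (-u₀))|) ^ 2
      + (2 * m * k * cos θ₀) ^ 2) = m * √(1 + k ^ 2) := by
    rw [abs_mul ε, abs_mul δ, hε, hδ, abs_of_pos (show 0 < m * exp u₀ by positivity),
      abs_of_pos (show 0 < m * exp (-u₀) by positivity)]
    have : (1 * (m * exp u₀) + 1 * (m * exp (-u₀))) ^ 2 + (2 * m * k * cos θ₀) ^ 2
        = (2 * m) ^ 2 * (1 + k ^ 2) := by
      have hch : exp u₀ + exp (-u₀) = 2 * cosh u₀ := by rw [cosh_eq]; ring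
      have hs := cosh_sq u₀
      rw [hu] at hs
      calc _ = m ^ 2 * (exp u₀ + exp (-u₀)) ^ 2 + (2 * m * k * cos θ₀) ^ 2 := by ring
        _ = _ := by
          rw [hch]
          linear_combination 4 * m ^ 2 * hs + 4 * m ^ 2 * k ^ 2 * sin_sq_add_cos_sq θ₀
    rw [this, sqrt_mul (by positivity), sqrt_sq (by positivity)]
    ring
  simp only [mu, Matrix.cons_val_zero, Matrix.cons_val_one, Matrix.cons_val]
  rw [e2, e3, sqrt_sq hm.le]

/-- The time in which the angle grows by a full turn. -/
lemma integral_period_eq {m : ℝ} (hm : 0 < m) (k t : ℝ) :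
    ∫ θ in t..t + 2 * π, (2 * m * √(1 + (k * sin θ) ^ 2))⁻¹
      = π / NNReal.agm m.toNNReal (m * √(1 + k ^ 2)).toNNReal := by
  have hper : Function.Periodic (fun θ => (2 * m * √(1 + (k * sin θ) ^ 2))⁻¹) (2 * π) :=
    fun x => by simp
  have h := ellipticIntegral_eq (x := m.toNNReal) (y := (m * √(1 + k ^ 2)).toNNReal)
    (by simpa using hm) (by rw [Real.toNNReal_pos]; positivity)
  rw [coe_toNNReal _ hm.le, coe_toNNReal _ (by positivity), ellipticIntegral] at h
  have hpt : ∀ θ, (2 * m * √(1 + (k * sin θ) ^ 2))⁻¹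
      = 2⁻¹ * (√(m ^ 2 * cos θ ^ 2 + (m * √(1 + k ^ 2)) ^ 2 * sin θ ^ 2))⁻¹ := fun θ => by
    have : m ^ 2 * cos θ ^ 2 + (m * √(1 + k ^ 2)) ^ 2 * sin θ ^ 2
        = m ^ 2 * (1 + (k * sin θ) ^ 2) := by
      rw [mul_pow, sq_sqrt (by positivity), cos_sq']; ring
    rw [this, sqrt_mul (by positivity), sqrt_sq hm.le, mul_assoc, mul_inv]
  rw [hper.intervalIntegral_add_eq t 0, zero_add]
  simp only [hpt]
  rw [intervalIntegral.integral_const_mul, h]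
  ring

/-- The rate is symmetric about an angle `c` at which `u` is extremal. -/
lemma integral_rate_eq_halfArc {k c : ℝ} (hk : k * cos c = 0) (α : ℝ) :
    ∫ θ in (c - α)..(c + α), rate (k * sin θ) = 2 * halfArc (k * sin c) α := by
  have h1 := intervalIntegral.integral_comp_add_left (a := -α) (b := α)
    (fun θ => rate (k * sin θ)) c
  have hpt : ∀ β, k * sin (c + β) = k * sin c * cos β := fun β => by
    rw [sin_add]; linear_combination sin β * hk
  simp only [hpt, ← sub_eq_add_neg] at h1
  have hi : ∀ a b, IntervalIntegrable (fun β => rate (k * sin c * cos β)) MeasureTheory.volume a b :=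
    fun a b => Continuous.intervalIntegrable (by fun_prop) _ _
  have h2 := intervalIntegral.integral_comp_neg (a := 0) (b := α)
    (fun β => rate (k * sin c * cos β))
  simp only [cos_neg, neg_zero] at h2
  rw [← h1, ← intervalIntegral.integral_add_adjacent_intervals (hi (-α) 0) (hi 0 α), ← h2, halfArc]
  ring

/-- A geodesic which returns to the plane `Π` while the angle grows by less than a full turn, or
which starts horizontally and makes exactly one turn, is symmetric about its midpoint, where `u` is
extremal. -/
lemma E_eq_returnCoord {m ε δ k θ₀ u₀ : ℝ} {V : Fin 3 → ℝ} (hm : 0 < m) (hε : |ε| = 1)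
    (hδ : |δ| = 1) (hu : sinh u₀ = k * sin θ₀) (hV : V = ![ε * (m * exp u₀),
      δ * (m * exp (-u₀)), 2 * m * k * cos θ₀]) :
    (mu V < π → E V 2 = 0 → ∃ l, ∃ α ∈ Ico 0 π,
      E V 0 = ε * returnCoord l α ∧ E V 1 = δ * returnCoord (-l) α) ∧
    (mu V = π → V 2 = 0 → ∃ l, E V 0 = ε * returnCoord l π ∧ E V 1 = δ * returnCoord (-l) π) := by
  obtain ⟨θ₁, htime, h0, h1, h2⟩ := exists_E_eq hm (by rw [← sq_abs, hε]; norm_num)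
    (by rw [← sq_abs, hδ]; norm_num) hu hV
  have hmu : mu V = NNReal.agm m.toNNReal (m * √(1 + k ^ 2)).toNNReal := by
    rw [hV]; exact mu_eq hm hε hδ hu
  have hperiod := integral_period_eq hm k θ₀
  rw [← hmu] at hperiod
  have hmu0 : 0 < mu V := by
    rw [hmu]
    exact_mod_cast NNReal.agm_pos (by simpa using hm) (by rw [Real.toNNReal_pos]; positivity)
  have hmono : StrictMono fun x => ∫ θ in θ₀..x, (2 * m * √(1 + (k * sin θ) ^ 2))⁻¹ := by
    refine strictMono_of_deriv_pos fun x => ?_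
    have hfc : Continuous fun x : ℝ => (2 * m * √(1 + (k * sin x) ^ 2))⁻¹ :=
      Continuous.inv₀ (by fun_prop) fun x => by positivity
    rw [(hasDerivAt_integral_of_continuous hfc θ₀ x).deriv]
    positivity
  -- Here `c` is the angle at the midpoint. The condition `k * cos c = 0` says that `u` is extremal
  -- there; it also holds for `k = 0`, when `u` vanishes identically.
  have key : ∀ c α, c - α = θ₀ → c + α = θ₁ → k * cos c = 0 →
      E V 0 = ε * returnCoord (k * sin c) α ∧ E V 1 = δ * returnCoord (-(k * sin c)) α := by
    intro c α hc₀ hc₁ hc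
    have hu' : u₀ = arsinh (k * sin c * cos α) := by
      rw [← arsinh_sinh u₀, hu, ← hc₀, sin_sub]
      congr 1
      linear_combination -sin α * hc
    have e1 := integral_rate_eq_halfArc hc α
    have e2 := integral_rate_eq_halfArc (k := -k) (c := c) (by linarith) α
    rw [hc₀, hc₁] at e1 e2
    simp only [neg_mul] at e2
    rw [h0, h1, e1, e2, hu']
    simp only [returnCoord, neg_mul, arsinh_neg, neg_neg]
    exact ⟨by ring, by ring⟩
  constructor
  · intro hsmall hplane
    have hlt₀ : θ₀ < θ₁ := hmono.lt_iff_lt.1 (by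
      rw [htime, intervalIntegral.integral_same]; exact one_pos)
    have hlt₁ : θ₁ < θ₀ + 2 * π := hmono.lt_iff_lt.1 (by
      rw [htime, hperiod, one_lt_div hmu0]
      exact hsmall)
    have hα : (θ₁ - θ₀) / 2 ∈ Ioo 0 π := ⟨by linarith, by linarith⟩
    refine ⟨k * sin ((θ₀ + θ₁) / 2), (θ₁ - θ₀) / 2, ⟨hα.1.le, hα.2⟩,
      key _ _ (by ring) (by ring) ?_⟩
    have hsin : k * sin θ₁ = k * sin θ₀ := by
      rw [← hu, ← sinh_arsinh (k * sin θ₁)]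
      congr 1
      linarith
    have hprod : k * cos ((θ₀ + θ₁) / 2) * sin ((θ₁ - θ₀) / 2) = 0 := by
      have := sin_sub_sin θ₁ θ₀
      rw [add_comm θ₁ θ₀] at this
      linear_combination hsin / 2 - k / 2 * this
    exact (mul_eq_zero.1 hprod).resolve_right (sin_pos_of_mem_Ioo hα).ne'
  · intro hperf hplane
    have hθ₁ : θ₁ = θ₀ + 2 * π := hmono.injective (by
      rw [htime, hperiod, hperf, div_self pi_ne_zero])
    refine ⟨k * sin (θ₀ + π), key _ _ (by ring) (by rw [hθ₁]; ring) ?_⟩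
    rw [hV] at hplane
    simp only [Matrix.cons_val] at hplane
    rw [cos_add_pi]
    have : 2 * m * (k * cos θ₀) = 0 := by linarith
    have := (mul_eq_zero.1 this).resolve_left (by positivity)
    linarith

lemma exists_velocity_eq {V : Fin 3 → ℝ} (h : V 0 * V 1 ≠ 0) :
    ∃ m ε δ k θ₀ u₀ : ℝ, 0 < m ∧ |ε| = 1 ∧ |δ| = 1 ∧ sinh u₀ = k * sin θ₀ ∧
      V = ![ε * (m * exp u₀), δ * (m * exp (-u₀)), 2 * m * k * cos θ₀] := by
  have h0 : V 0 ≠ 0 := left_ne_zero_of_mul h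
  have h1 : V 1 ≠ 0 := right_ne_zero_of_mul h
  have hsgn : ∀ x : ℝ, ∃ ε : ℝ, |ε| = 1 ∧ x = ε * |x| := fun x => by
    rcases abs_cases x with ⟨e, _⟩ | ⟨e, _⟩
    · exact ⟨1, by simp, by rw [e, one_mul]⟩
    · exact ⟨-1, by simp, by rw [e]; ring⟩
  obtain ⟨ε, hε, hV0⟩ := hsgn (V 0)
  obtain ⟨δ, hδ, hV1⟩ := hsgn (V 1)
  have hx : 0 < |V 0| := abs_pos.2 h0
  have hy : 0 < |V 1| := abs_pos.2 h1
  have hexp : ∀ x : ℝ, 0 < x → exp (log x / 2) ^ 2 = x := fun x hx => by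
    rw [← exp_nat_mul, Nat.cast_two, mul_div_cancel₀ _ two_ne_zero, exp_log hx]
  set a := log |V 0| / 2
  set b := log |V 1| / 2
  obtain ⟨k, θ₀, hc, hs⟩ := exists_polar (V 2 / (2 * exp (a + b))) (sinh (a - b))
  refine ⟨exp (a + b), ε, δ, k, θ₀, a - b, exp_pos _, hε, hδ, hs, ?_⟩
  have e0 : exp (a + b) * exp (a - b) = |V 0| := by
    rw [← hexp _ hx, ← exp_add, ← exp_nat_mul]; congr 1; push_cast; ring
  have e1 : exp (a + b) * exp (-(a - b)) = |V 1| := by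
    rw [← hexp _ hy, ← exp_add, ← exp_nat_mul]; congr 1; push_cast; ring
  have e2 : 2 * exp (a + b) * k * cos θ₀ = V 2 := by
    rw [mul_assoc, ← hc]; field_simp
  rw [e0, e1, e2, ← hV0, ← hV1]
  funext i
  fin_cases i <;> rfl

/-! ### Separation in the plane -/

/-- The points `(x, y, z)` such that `(|x|, |y|)` lies on the curve traced by the end points of the
symmetric arcs of a full period. -/
noncomputable def fullPeriodSet : Set (Fin 3 → ℝ) :=
  {p | (|p 0|, |p 1|) ∈ range fun k => (returnCoord k π, returnCoord (-k) π)}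

lemma isClosed_fullPeriodSet : IsClosed fullPeriodSet :=
  isClosed_range_returnCoord_pi.preimage (f := fun p : Fin 3 → ℝ => (|p 0|, |p 1|)) (by fun_prop)

lemma mul_ne_zero_of_mem_fullPeriodSet {p : Fin 3 → ℝ} (hp : p ∈ fullPeriodSet) :
    p 0 * p 1 ≠ 0 := by
  obtain ⟨k, hk⟩ := hp
  obtain ⟨h0, h1⟩ := Prod.mk.inj hk
  have hpos : ∀ k, 0 < returnCoord k π := fun k => by
    rw [returnCoord_pi]
    exact mul_pos (exp_pos _) (by linarith [one_le_two_mul_halfArc_pi k])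
  exact mul_ne_zero (abs_pos.1 (h0 ▸ hpos k)) (abs_pos.1 (h1 ▸ hpos (-k)))

lemma boundaryCurves_subset_fullPeriodSet : boundaryCurves ⊆ fullPeriodSet := by
  rintro _ ⟨V, ⟨hV, hplane⟩, rfl⟩
  have hV' : mu V = π := hV
  have h : V 0 * V 1 ≠ 0 := fun h => pi_ne_zero (by rw [← hV', mu, h]; simp)
  obtain ⟨m, ε, δ, k, θ₀, u₀, hm, hε, hδ, hu, hVeq⟩ := exists_velocity_eq h
  obtain ⟨l, h0, h1⟩ := (E_eq_returnCoord hm hε hδ hu hVeq).2 hV hplane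
  have hnn : ∀ k, 0 ≤ returnCoord k π := fun k => by
    rw [returnCoord_pi]
    exact mul_nonneg (exp_pos _).le (by linarith [one_le_two_mul_halfArc_pi k])
  exact ⟨l, by simp [h0, h1, abs_mul, hε, hδ, abs_of_nonneg (hnn _)]⟩

lemma isClosed_plane : IsClosed plane :=
  isClosed_eq (continuous_apply 2) continuous_const

lemma convex_plane : Convex ℝ plane := fun x hx y hy a b _ _ _ => by
  have hx' : x 2 = 0 := hx
  have hy' : y 2 = 0 := hy
  simp [plane, hx', hy']

/-- The image of a small vector can be joined to the origin within the plane `Π`, avoiding the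
images of perfect vectors: by a segment if it lies on an axis, and otherwise by the end points of
the shorter symmetric arcs about the same midpoint. -/
lemma E_mem_connectedComponentIn {V : Fin 3 → ℝ} (hV : V ∈ smallVectors) (hE : E V ∈ plane) :
    E V ∈ connectedComponentIn (plane \ fullPeriodSet) 0 := by
  by_cases h : V 0 * V 1 = 0
  · have hprod := E_zero_mul_E_one_eq_zero h
    refine (convex_segment (𝕜 := ℝ) 0 (E V)).isPreconnected.subset_connectedComponentIn
      (left_mem_segment _ _ _) ?_ (right_mem_segment _ _ _)
    intro p hp
    refine ⟨convex_plane.segment_subset (show (0 : Fin 3 → ℝ) ∈ plane from rfl) hE hp,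
      fun hp' => mul_ne_zero_of_mem_fullPeriodSet hp' ?_⟩
    rw [segment_eq_image] at hp
    obtain ⟨s, _, rfl⟩ := hp
    simp only [smul_zero, zero_add, Pi.smul_apply, smul_eq_mul]
    linear_combination s ^ 2 * hprod
  · obtain ⟨m, ε, δ, k, θ₀, u₀, hm, hε, hδ, hu, hVeq⟩ := exists_velocity_eq h
    obtain ⟨l, α, hα, h0, h1⟩ := (E_eq_returnCoord hm hε hδ hu hVeq).1 hV hE
    let c : ℝ → Fin 3 → ℝ := fun s => ![ε * returnCoord l s, δ * returnCoord (-l) s, 0]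
    have hc : Continuous c := continuous_pi fun i => by
      have := continuous_returnCoord l
      have := continuous_returnCoord (-l)
      fin_cases i <;> simp [c] <;> fun_prop
    have hnn : ∀ k, ∀ s ∈ Icc 0 α, 0 ≤ returnCoord k s := fun k s hs => by
      have : 0 ≤ halfArc k s := by
        rw [← halfArc_zero k]; exact (strictMono_halfArc k).monotone hs.1
      unfold returnCoord; positivity
    have hc0 : c 0 = 0 := by
      funext i; fin_cases i <;> simp [c, returnCoord]
    have hcα : c α = E V := by
      funext i
      fin_cases i
      · exact h0.symm
      · exact h1.symm
      · exact hE.symm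
    refine (isPreconnected_Icc.image c hc.continuousOn).subset_connectedComponentIn
      ⟨0, ⟨le_rfl, hα.1⟩, hc0⟩ ?_ ⟨α, ⟨hα.1, le_rfl⟩, hcα⟩
    rintro _ ⟨s, hs, rfl⟩
    refine ⟨rfl, ?_⟩
    rintro ⟨k', hk'⟩
    obtain ⟨e0, e1⟩ := Prod.mk.inj hk'
    simp only [c, Matrix.cons_val_zero, Matrix.cons_val_one, abs_mul, hε, hδ, one_mul,
      abs_of_nonneg (hnn _ s hs)] at e0 e1
    exact returnCoord_ne ⟨hs.1, hs.2.trans_lt hα.2⟩ k' e0.symm e1.symm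

/-- Components of the complement of `fullPeriodSet` in the plane are relatively open. -/
lemma notMem_boundaryN {x : Fin 3 → ℝ}
    (hx : x ∈ connectedComponentIn (plane \ fullPeriodSet) 0) : x ∉ boundaryN := by
  intro hcl
  have hxS := connectedComponentIn_subset _ _ hx
  obtain ⟨r, hr, hball⟩ := Metric.isOpen_iff.1 isClosed_fullPeriodSet.isOpen_compl x hxS.2
  obtain ⟨y, hy, hxy⟩ := Metric.mem_closure_iff.1 hcl r hr
  have hsub : Metric.ball x r ∩ plane ⊆ connectedComponentIn (plane \ fullPeriodSet) x :=
    ((convex_ball x r).inter convex_plane).isPreconnected.subset_connectedComponentIn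
      ⟨Metric.mem_ball_self hr, hxS.1⟩ fun p hp => ⟨hp.2, hball hp.1⟩
  rw [← connectedComponentIn_eq hx] at hsub
  refine hy.2 (connectedComponentIn_mono 0
    (sdiff_subset_sdiff_right boundaryCurves_subset_fullPeriodSet) (hsub ⟨?_, hy.1.1⟩))
  rwa [Metric.mem_ball, dist_comm]

end Sol

theorem corollary3p4 : Sol.E '' Sol.smallVectors ⊆ Sol.N := by
  rintro _ ⟨V, hV, rfl⟩ hcl
  have hplane : Sol.E V ∈ Sol.plane :=
    closure_minimal (fun _ hp => hp.1.1) Sol.isClosed_plane hcl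
  exact Sol.notMem_boundaryN (Sol.E_mem_connectedComponentIn hV hplane) hcl
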